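/- **Setting.** In online bipartite matching, a finite set $S$ of servers is known in advance, and requests $1,\dots,n$ arrive one by one; when $r$ arrives, its neighbourhood $N(r)\subseteq S$ is revealed, and $r$ must be irrevocably matched to a still unmatched neighbour or left unmatched forever. The graph is $(d,d)$-bounded if every server has degree at least $d$ and every request has degree at most $d$. Given a non-decreasing $f:\mathbb N\to\mathbb R$ with $f(0)=1$ (here $0\in\mathbb N$), the OCS-based algorithm with $f$ works as follows: when $r$ arrives, let $A$ be the set of unmatched neighbours of $r$ and, for $s\in A$, let $l_s$ be the number of neighbours of $s$ that arrived before $r$; if $A\neq\emptyset$, match $r$ to $s\in A$ with probability $f(l_s)/\sum_{s'\in A}f(l_{s'})$, using fresh randomness. Its competitive ratio on $(d,d)$-bounded graphs is the infimum of $\mathbb E[\mathsf{ALG}]/\mathsf{OPT}$ over all $(d,d)$-bounded instances with $\mathsf{OPT}>0$, where $\mathsf{ALG}$ is the size of the matching it produces and $\mathsf{OPT}$ the size of a maximum matching. For $d\ge 2$, let $\mathcal C_d$ be the set of non-decreasing $f:\mathbb N\to\mathbb R$ with $f(0)=1$ such that for all integers $0\le m\le d-1$ and $0\le l_1\le\dots\le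 l_m$, $$1+\frac{\sum_{i=1}^m f(l_i)}{d-m}\;\ge\;\prod_{i=1}^m\frac{f(l_i+1)}{f(l_i)} .$$ The optimal candidate function is the $f_d\in\mathcal C_d$ with $f_d(l)\ge f(l)$ for all $f\in\mathcal C_d$ and all $l\ge 0$. For $d\ge 1$ define $g_d(0)=1$ and, for $l\ge 1$, $$g_d(l)=g_d(l-1)\cdot\inf_{t\in(0,1)}\left(1+\frac{t\,g_d(l-1)}{1-t}\right)^{\frac1{td}} .$$ **Theorem.** The optimal candidate function $f_d$ exists (and is then clearly unique) for every $d\ge 2$, and the following hold. 1. There is $d_0$ such that for every $d\ge d_0$ the competitive ratio of the OCS-based algorithm with $f_d$ on $(d,d)$-bounded graphs is at least $0.8976$. 2. $f_d(l)\ge g_d(l)$ for all $d\ge 2$ and $l\ge 0$. 3. $g_{2d}(2l)\ge g_d(l)$ for all $d\ge 1$ and $l\ge 0$. 4. $g_{10000}(10000)\ge 9.7657$. -/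

import Mathlib

open scoped ENNReal

/-! ### Online bipartite matching instances -/

/-- An instance of online bipartite matching: the servers `Fin numServers` are known offline, the
requests `Fin numRequests` arrive one by one in increasing order, and `nbr r` is the set `N(r)` of
the servers adjacent to the request `r`. -/
structure OnlineInstance where
  numServers : ℕ
  numRequests : ℕ
  nbr : Fin numRequests → Finset (Fin numServers)

namespace OnlineInstance

/-- A set of (request, server) pairs; the matchings will be sets of this kind. -/
abbrev EdgeSet (I : OnlineInstance) : Type := Finset (Fin I.numRequests × Fin I.numServers)

/-- The degree `d(s)` of a server. -/
def serverDegree (I : OnlineInstance) (s : Fin I.numServers) : ℕ :=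
  (Finset.univ.filter fun r : Fin I.numRequests => s ∈ I.nbr r).card

/-- The degree `d(r)` of a request. -/
def requestDegree (I : OnlineInstance) (r : Fin I.numRequests) : ℕ :=
  (I.nbr r).card

/-- `(k, d)`-bounded graphs: servers have degree at least `k`, requests degree at most `d`. -/
def IsBounded (I : OnlineInstance) (k d : ℕ) : Prop :=
  (∀ s, k ≤ I.serverDegree s) ∧ ∀ r, I.requestDegree r ≤ d

/-- Matchings of the bipartite graph of the instance. -/
def IsMatching (I : OnlineInstance) (M : I.EdgeSet) : Prop :=
  (∀ e ∈ M, e.2 ∈ I.nbr e.1) ∧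
    ∀ e ∈ M, ∀ e' ∈ M, (e.1 = e'.1 ∨ e.2 = e'.2) → e = e'

open Classical in
/-- `OPT`: the size of a maximum matching. -/
noncomputable def opt (I : OnlineInstance) : ℕ :=
  (Finset.univ.filter fun M : I.EdgeSet => I.IsMatching M).sup Finset.card

/-! ### The OCS-based algorithm -/

/-- The number of neighbours of the server `s` that have arrived before the request `r`. -/
def arrivedBefore (I : OnlineInstance) (r : Fin I.numRequests) (s : Fin I.numServers) : ℕ :=
  (Finset.univ.filter fun r' : Fin I.numRequests => r' < r ∧ s ∈ I.nbr r').card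

/-- The neighbours of the request `r` that are left unmatched by `M`. -/
def available (I : OnlineInstance) (r : Fin I.numRequests) (M : I.EdgeSet) :
    Finset (Fin I.numServers) :=
  (I.nbr r).filter fun s => ∀ e ∈ M, e.2 ≠ s

/-- The (unnormalized) weight with which the arriving request `r` picks the server `s`. -/
noncomputable def weight (I : OnlineInstance) (f : ℕ → ℝ) (r : Fin I.numRequests)
    (M : I.EdgeSet) (s : Fin I.numServers) : ℝ≥0∞ :=
  if s ∈ I.available r M then ENNReal.ofReal (f (I.arrivedBefore r s)) else 0

theorem tsum_weight_ne_top (I : OnlineInstance) (f : ℕ → ℝ) (r : Fin I.numRequests)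
    (M : I.EdgeSet) : ∑' s, I.weight f r M s ≠ ∞ := by
  rw [tsum_fintype]
  refine ENNReal.sum_ne_top.2 fun s _ => ?_
  unfold weight
  split_ifs
  · exact ENNReal.ofReal_ne_top
  · exact ENNReal.zero_ne_top

/-- For the sequences `f` that the algorithm uses, the total weight vanishes exactly when the
request has no unmatched neighbour. -/
theorem tsum_weight_ne_zero_iff (I : OnlineInstance) (f : ℕ → ℝ) (hf : Monotone f)
    (h0 : f 0 = 1) (r : Fin I.numRequests) (M : I.EdgeSet) :
    ∑' s, I.weight f r M s ≠ 0 ↔ (I.available r M).Nonempty := by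
  have hpos : ∀ l, 0 < f l := fun l => by
    have := hf (Nat.zero_le l)
    linarith
  rw [tsum_fintype, Ne, Finset.sum_eq_zero_iff]
  constructor
  · intro h
    by_contra hA
    rw [Finset.not_nonempty_iff_eq_empty] at hA
    exact h fun s _ => by simp [weight, hA]
  · rintro ⟨s, hs⟩ h
    have := h s (Finset.mem_univ s)
    simp only [weight, hs, if_true, ENNReal.ofReal_eq_zero] at this
    exact absurd this (not_le.2 (hpos _))

/-- One round of the algorithm: if the request `r` has an unmatched neighbour, it is matched to the
unmatched neighbour `s` with probability `f (l_s) / ∑ s', f (l_s')`, the sum being over all the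
unmatched neighbours `s'` of `r`; otherwise nothing happens. -/
noncomputable def round (I : OnlineInstance) (f : ℕ → ℝ) (r : Fin I.numRequests)
    (M : I.EdgeSet) : PMF I.EdgeSet :=
  if h : ∑' s, I.weight f r M s ≠ 0 then
    (PMF.normalize (I.weight f r M) h (I.tsum_weight_ne_top f r M)).map fun s => insert (r, s) M
  else PMF.pure M

/-- The law of the matching built by the algorithm after the first `i` requests. -/
noncomputable def lawAfter (I : OnlineInstance) (f : ℕ → ℝ) : ℕ → PMF I.EdgeSet
  | 0 => PMF.pure ∅
  | i + 1 => (lawAfter I f i).bind fun M =>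
      if h : i < I.numRequests then I.round f ⟨i, h⟩ M else PMF.pure M

/-- `E[ALG]`: the expected size of the matching that the algorithm has built at the end. -/
noncomputable def expectedAlg (I : OnlineInstance) (f : ℕ → ℝ) : ℝ :=
  ∑ M : I.EdgeSet, (I.lawAfter f I.numRequests M).toReal * (M.card : ℝ)

end OnlineInstance

/-- The competitive ratio on `(k, d)`-bounded graphs of the OCS-based algorithm run with `f`: the
infimum of `E[ALG] / OPT` over all the instances (those with `OPT > 0`, so that the quotient makes
sense). -/
noncomputable def ocsCompetitiveRatio (k d : ℕ) (f : ℕ → ℝ) : ℝ :=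
  sInf {ρ : ℝ | ∃ I : OnlineInstance, I.IsBounded k d ∧ 0 < I.opt ∧
    ρ = I.expectedAlg f / (I.opt : ℝ)}

/-! ### Candidate functions -/

/-- The set `C_d` of candidate functions. -/
def IsCandidate (d : ℕ) (f : ℕ → ℝ) : Prop :=
  Monotone f ∧ f 0 = 1 ∧
    ∀ m : ℕ, m < d → ∀ l : Fin m → ℕ, Monotone l →
      ∏ i, f (l i + 1) / f (l i) ≤ 1 + (∑ i, f (l i)) / ((d : ℝ) - (m : ℝ))

/-- The optimal candidate function: the pointwise largest element of `C_d`. -/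
def IsOptimalCandidate (d : ℕ) (f : ℕ → ℝ) : Prop :=
  IsCandidate d f ∧ ∀ h : ℕ → ℝ, IsCandidate d h → ∀ l : ℕ, h l ≤ f l

/-- The auxiliary recursion `g_d`. -/
noncomputable def auxG (d : ℕ) : ℕ → ℝ
  | 0 => 1
  | l + 1 => auxG d l *
      ⨅ t : Set.Ioo (0 : ℝ) 1,
        (1 + (t : ℝ) * auxG d l / (1 - (t : ℝ))) ^ (1 / ((t : ℝ) * (d : ℝ)))

/-! Constraints with all arguments equal bound a candidate at `l + 1` in terms of its value at `l`.
The greedy function takes the largest value these allow. It meets the mixed constraints as well: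
each factor is at most an m-th root of 1 + m f(l_i) / (d - m), and AM-GM bounds the product of these
roots by their average. Hence it is the optimal candidate, and relaxing t = m / d to all t in (0, 1)
gives `auxG` as a lower bound.

For the competitive ratio, `survival_le` shows by induction on the requests that every set U of
servers is entirely unmatched with probability at most the product of 1 / f(l_s) over U. In a round
U survives with probability X / (X + c), where c is the weight of the neighbours inside U and X that
of the free neighbours outside. Concavity in X, the induction hypothesis for the sets U ∪ {s}, and
the candidate inequality close the step. Singletons then give the ratio 1 - 1 / f(d), so a bound
f_d(d) ≥ 9.7657 is enough.

For the numerics, `auxG d` multiplies x by exp(c(x) / d), where c(x) is the infimum of log(1 + t x /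
(1 - t)) / t: an exponential Euler scheme for x' = x c(x) with step 1 / d. Since c is concave,
chords between certified points (`isRateBound_of_exp_le`) bound it from below (`IsRateBound.chord`).
A single integer simulation, with step slightly below 1 / 10000, serves d = 10000 and all d ≥ 10¹¹.
-/

/-! ### The greedy candidate function -/

/-- The largest function that satisfies the constraints of `IsCandidate` for constant tuples. -/
noncomputable def greedyCandidate (d : ℕ) : ℕ → ℝ
  | 0 => 1
  | l + 1 => greedyCandidate d l *
      ⨅ m : {m : ℕ // 1 ≤ m ∧ m < d},
        (1 + (m : ℝ) * greedyCandidate d l / ((d : ℝ) - (m : ℝ))) ^ (1 / ((m : ℕ) : ℝ))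

theorem one_le_one_add_mul_div_sub {d m : ℕ} (h : m < d) {x : ℝ} (hx : 0 ≤ x) :
    1 ≤ 1 + (m : ℝ) * x / ((d : ℝ) - (m : ℝ)) := by
  have : (m : ℝ) < d := by exact_mod_cast h
  have : 0 ≤ (m : ℝ) * x / ((d : ℝ) - (m : ℝ)) :=
    div_nonneg (by positivity) (by linarith)
  linarith

theorem bddBelow_range_rpow {d : ℕ} {x : ℝ} (hx : 0 ≤ x) :
    BddBelow (Set.range fun m : {m : ℕ // 1 ≤ m ∧ m < d} =>
      (1 + (m : ℝ) * x / ((d : ℝ) - (m : ℝ))) ^ (1 / ((m : ℕ) : ℝ))) := by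
  refine ⟨1, ?_⟩
  rintro _ ⟨m, rfl⟩
  exact Real.one_le_rpow (one_le_one_add_mul_div_sub m.2.2 hx) (by positivity)

theorem nonempty_index {d : ℕ} (hd : 2 ≤ d) : Nonempty {m : ℕ // 1 ≤ m ∧ m < d} :=
  ⟨⟨1, le_rfl, hd⟩⟩

theorem one_le_iInf_rpow {d : ℕ} (hd : 2 ≤ d) {x : ℝ} (hx : 0 ≤ x) :
    1 ≤ ⨅ m : {m : ℕ // 1 ≤ m ∧ m < d},
      (1 + (m : ℝ) * x / ((d : ℝ) - (m : ℝ))) ^ (1 / ((m : ℕ) : ℝ)) := by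
  have := nonempty_index hd
  exact le_ciInf fun m =>
    Real.one_le_rpow (one_le_one_add_mul_div_sub m.2.2 hx) (by positivity)

theorem one_le_greedyCandidate {d : ℕ} (hd : 2 ≤ d) (l : ℕ) : 1 ≤ greedyCandidate d l := by
  induction l with
  | zero => exact le_rfl
  | succ l ih =>
    rw [greedyCandidate]
    exact one_le_mul_of_one_le_of_one_le ih (one_le_iInf_rpow hd (by linarith))

theorem monotone_greedyCandidate {d : ℕ} (hd : 2 ≤ d) : Monotone (greedyCandidate d) := by
  refine monotone_nat_of_le_succ fun l => ?_
  have h := one_le_greedyCandidate hd l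
  rw [greedyCandidate]
  exact le_mul_of_one_le_right (by linarith) (one_le_iInf_rpow hd (by linarith))

theorem greedyCandidate_ratio_le {d m : ℕ} (hd : 2 ≤ d) (hm : 1 ≤ m) (hmd : m < d) (l : ℕ) :
    greedyCandidate d (l + 1) / greedyCandidate d l ≤
      (1 + (m : ℝ) * greedyCandidate d l / ((d : ℝ) - (m : ℝ))) ^ (1 / (m : ℝ)) := by
  have h := one_le_greedyCandidate hd l
  rw [greedyCandidate, mul_div_cancel_left₀ _ (by linarith)]
  exact ciInf_le (bddBelow_range_rpow (by linarith)) (⟨m, hm, hmd⟩ : {m : ℕ // 1 ≤ m ∧ m < d})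

/-- Weighted AM-GM with equal weights 1 / m reduces mixed tuples to constant ones. -/
theorem isCandidate_greedyCandidate {d : ℕ} (hd : 2 ≤ d) : IsCandidate d (greedyCandidate d) := by
  refine ⟨monotone_greedyCandidate hd, rfl, fun m hm l _ => ?_⟩
  rcases Nat.eq_zero_or_pos m with rfl | hm0
  · simp
  have hmpos : (0 : ℝ) < m := by exact_mod_cast hm0
  have hpos : ∀ k, 0 < greedyCandidate d k := fun k =>
    lt_of_lt_of_le one_pos (one_le_greedyCandidate hd k)
  calc ∏ i, greedyCandidate d (l i + 1) / greedyCandidate d (l i)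
      ≤ ∏ i, (1 + (m : ℝ) * greedyCandidate d (l i) / ((d : ℝ) - (m : ℝ))) ^ (1 / (m : ℝ)) :=
        Finset.prod_le_prod (fun i _ => (div_pos (hpos _) (hpos _)).le)
          fun i _ => greedyCandidate_ratio_le hd hm0 hm (l i)
    _ ≤ ∑ i, 1 / (m : ℝ) * (1 + (m : ℝ) * greedyCandidate d (l i) / ((d : ℝ) - (m : ℝ))) :=
        Real.geom_mean_le_arith_mean_weighted _ _ _ (fun _ _ => by positivity)
          (by simp [hmpos.ne']) fun i _ =>
            zero_le_one.trans (one_le_one_add_mul_div_sub hm (hpos _).le)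
    _ = 1 + (∑ i, greedyCandidate d (l i)) / ((d : ℝ) - (m : ℝ)) := by
        rw [Finset.sum_div, ← Finset.mul_sum, Finset.sum_add_distrib, mul_add, Finset.mul_sum,
          Finset.mul_sum]
        congr 1
        · simp [hmpos.ne']
        · exact Finset.sum_congr rfl fun i _ => by field_simp

theorem IsCandidate.succ_le {d m : ℕ} {h : ℕ → ℝ} (hh : IsCandidate d h) (hm : 1 ≤ m)
    (hmd : m < d) (l : ℕ) :
    h (l + 1) ≤ h l * (1 + (m : ℝ) * h l / ((d : ℝ) - (m : ℝ))) ^ (1 / (m : ℝ)) := by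
  obtain ⟨hmono, h0, hc⟩ := hh
  have hpos : ∀ k, 0 < h k := fun k => by
    have := hmono (Nat.zero_le k)
    linarith
  have key := hc m hmd (fun _ => l) monotone_const
  simp only [Finset.prod_const, Finset.card_univ, Fintype.card_fin, Finset.sum_const,
    nsmul_eq_mul] at key
  have hq : 0 ≤ h (l + 1) / h l := (div_pos (hpos _) (hpos _)).le
  rw [mul_comm, ← div_le_iff₀ (hpos l)]
  calc h (l + 1) / h l = ((h (l + 1) / h l) ^ m) ^ (1 / (m : ℝ)) := by
        rw [one_div, Real.pow_rpow_inv_natCast hq (by omega)]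
    _ ≤ _ := Real.rpow_le_rpow (by positivity) key (by positivity)

/-- Maximality is inductive: x (1 + m x / (d - m)) ^ (1 / m) increases with x, so a larger value at
`l` allows a larger one at `l + 1`. -/
theorem isOptimalCandidate_greedyCandidate {d : ℕ} (hd : 2 ≤ d) :
    IsOptimalCandidate d (greedyCandidate d) := by
  refine ⟨isCandidate_greedyCandidate hd, fun h hh l => ?_⟩
  induction l with
  | zero => exact hh.2.1.le
  | succ l ih =>
    have := nonempty_index hd
    have hg := one_le_greedyCandidate hd l
    have hl : 1 ≤ h l := hh.2.1 ▸ hh.1 (Nat.zero_le l)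
    rw [greedyCandidate, mul_comm, ← div_le_iff₀ (by linarith)]
    refine le_ciInf fun m => ?_
    rw [div_le_iff₀ (by linarith), mul_comm]
    have hm : ((m : ℕ) : ℝ) < d := by exact_mod_cast m.2.2
    refine (hh.succ_le m.2.1 m.2.2 l).trans ?_
    have h1 := one_le_one_add_mul_div_sub m.2.2 (zero_le_one.trans hl)
    gcongr

/-! ### The auxiliary recursion -/

/-- The growth factor in the recursion that defines `auxG`. -/
noncomputable def growth (d : ℕ) (x : ℝ) : ℝ :=
  ⨅ t : Set.Ioo (0 : ℝ) 1, (1 + (t : ℝ) * x / (1 - (t : ℝ))) ^ (1 / ((t : ℝ) * (d : ℝ)))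

theorem auxG_succ (d l : ℕ) : auxG d (l + 1) = auxG d l * growth d (auxG d l) := rfl

instance nonempty_unitIoo : Nonempty (Set.Ioo (0 : ℝ) 1) := ⟨⟨1 / 2, by norm_num, by norm_num⟩⟩

theorem one_le_one_add_mul_div {t x : ℝ} (ht : t ∈ Set.Ioo (0 : ℝ) 1) (hx : 0 ≤ x) :
    1 ≤ 1 + t * x / (1 - t) := by
  have : 0 ≤ t * x / (1 - t) := div_nonneg (mul_nonneg ht.1.le hx) (by linarith [ht.2])
  linarith

theorem one_le_growth_term (d : ℕ) {x : ℝ} (hx : 0 ≤ x) (t : Set.Ioo (0 : ℝ) 1) :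
    1 ≤ (1 + (t : ℝ) * x / (1 - (t : ℝ))) ^ (1 / ((t : ℝ) * (d : ℝ))) := by
  have := t.2.1.le
  exact Real.one_le_rpow (one_le_one_add_mul_div t.2 hx) (by positivity)

theorem growth_le (d : ℕ) {x : ℝ} (hx : 0 ≤ x) (t : Set.Ioo (0 : ℝ) 1) :
    growth d x ≤ (1 + (t : ℝ) * x / (1 - (t : ℝ))) ^ (1 / ((t : ℝ) * (d : ℝ))) :=
  ciInf_le ⟨1, by rintro _ ⟨t, rfl⟩; exact one_le_growth_term d hx t⟩ t

theorem one_le_growth (d : ℕ) {x : ℝ} (hx : 0 ≤ x) : 1 ≤ growth d x :=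
  le_ciInf fun t => one_le_growth_term d hx t

theorem growth_mono (d : ℕ) {x y : ℝ} (hx : 0 ≤ x) (hxy : x ≤ y) : growth d x ≤ growth d y := by
  refine le_ciInf fun t => (growth_le d hx t).trans ?_
  have h0 := t.2.1.le
  have h1 : 0 < 1 - (t : ℝ) := by linarith [t.2.2]
  gcongr

theorem one_le_auxG (d l : ℕ) : 1 ≤ auxG d l := by
  induction l with
  | zero => exact le_rfl
  | succ l ih =>
    rw [auxG_succ]
    exact one_le_mul_of_one_le_of_one_le ih (one_le_growth d (by linarith))

theorem auxG_monotone (d : ℕ) : Monotone (auxG d) := by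
  refine monotone_nat_of_le_succ fun l => ?_
  have h := one_le_auxG d l
  rw [auxG_succ]
  exact le_mul_of_one_le_right (by linarith) (one_le_growth d (by linarith))

theorem auxG_le_greedyCandidate {d : ℕ} (hd : 2 ≤ d) (l : ℕ) :
    auxG d l ≤ greedyCandidate d l := by
  induction l with
  | zero => exact le_rfl
  | succ l ih =>
    have := nonempty_index hd
    have hg := one_le_auxG d l
    have hf := one_le_greedyCandidate hd l
    rw [auxG_succ, greedyCandidate]
    refine mul_le_mul ih (le_ciInf fun m => ?_)
      (zero_le_one.trans (one_le_growth d (by linarith))) (by linarith)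
    have hm : ((m : ℕ) : ℝ) < d := by exact_mod_cast m.2.2
    have hm0 : (0 : ℝ) < ((m : ℕ) : ℝ) := by exact_mod_cast m.2.1
    have hd0 : (0 : ℝ) < d := by linarith
    -- With t = m / d the term of `growth` becomes exactly the term of index m in the greedy
    -- recursion.
    refine (growth_mono d (by linarith) ih).trans
      ((growth_le d (by linarith) ⟨(m : ℝ) / d, by positivity, (div_lt_one hd0).2 hm⟩).trans
        (le_of_eq ?_))
    have hdm : (d : ℝ) - ((m : ℕ) : ℝ) ≠ 0 := by linarith
    have h1 : (1 : ℝ) - ((m : ℕ) : ℝ) / d ≠ 0 := by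
      rw [one_sub_div hd0.ne']
      exact div_ne_zero hdm hd0.ne'
    congr 2
    · rw [one_sub_div hd0.ne']
      field_simp
    field_simp

/-- Doubling d halves the exponent 1 / (t d), so each term is replaced by its square root. -/
theorem growth_le_growth_two_mul_sq (d : ℕ) {x : ℝ} (hx : 0 ≤ x) :
    growth d x ≤ growth (2 * d) x * growth (2 * d) x := by
  have h : √(growth d x) ≤ growth (2 * d) x := by
    refine le_ciInf fun t => ?_
    have h1 := one_le_one_add_mul_div t.2 hx
    refine (Real.sqrt_le_sqrt (growth_le d hx t)).trans (le_of_eq ?_)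
    rw [Real.sqrt_eq_rpow, ← Real.rpow_mul (by linarith)]
    congr 1
    push_cast
    rw [div_mul_div_comm]
    ring_nf
  calc growth d x = √(growth d x) * √(growth d x) :=
        (Real.mul_self_sqrt (zero_le_one.trans (one_le_growth d hx))).symm
    _ ≤ _ := mul_self_le_mul_self (Real.sqrt_nonneg _) h

/-- Two steps for 2d at the same x multiply to at least one step for d, and the second is actually
taken from a larger x. -/
theorem auxG_le_auxG_two_mul (d l : ℕ) : auxG d l ≤ auxG (2 * d) (2 * l) := by
  induction l with
  | zero => exact le_rfl
  | succ l ih =>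
    have hg := one_le_auxG d l
    have hG := one_le_auxG (2 * d) (2 * l)
    have hG' : auxG (2 * d) (2 * l) ≤ auxG (2 * d) (2 * l + 1) := auxG_monotone _ (Nat.le_succ _)
    have h1 := one_le_growth (2 * d) (x := auxG d l) (by linarith)
    rw [auxG_succ, show 2 * (l + 1) = 2 * l + 1 + 1 by ring, auxG_succ (2 * d) (2 * l + 1),
      auxG_succ (2 * d) (2 * l)]
    rw [auxG_succ] at hG'
    have hpos : 0 ≤ auxG (2 * d) (2 * l) * growth (2 * d) (auxG (2 * d) (2 * l)) := by linarith
    calc auxG d l * growth d (auxG d l)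
        ≤ auxG d l * (growth (2 * d) (auxG d l) * growth (2 * d) (auxG d l)) := by
          gcongr
          exact growth_le_growth_two_mul_sq d (by linarith)
      _ = auxG d l * growth (2 * d) (auxG d l) * growth (2 * d) (auxG d l) := by ring
      _ ≤ _ := by
          have e1 := growth_mono (2 * d) (by linarith) ih
          have e2 := growth_mono (2 * d) (by linarith) (ih.trans hG')
          gcongr

/-! ### Lower bounds for the growth rate -/

/-- `c` is a lower bound for `log (1 + t x / (1 - t)) / t` on the unit interval. -/
def IsRateBound (x c : ℝ) : Prop :=
  ∀ t ∈ Set.Ioo (0 : ℝ) 1, c * t ≤ Real.log (1 + t * x / (1 - t))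

/-- This is what makes rounding safe: x may be rounded up and c down. -/
theorem IsRateBound.mono {x y c c' : ℝ} (h : IsRateBound x c) (hx : 0 ≤ x) (hxy : x ≤ y)
    (hc : c' ≤ c) : IsRateBound y c' := fun t ht => by
  have h0 := ht.1.le
  have h1 : 0 < 1 - t := by linarith [ht.2]
  have h2 := one_le_one_add_mul_div ht hx
  calc c' * t ≤ c * t := by gcongr
    _ ≤ _ := h t ht
    _ ≤ _ := Real.log_le_log (by linarith) (by gcongr)

/-- For fixed t the logarithm is concave in x, so rate bounds interpolate linearly. -/
theorem IsRateBound.chord {x₀ x₁ c₀ c₁ x : ℝ} (h₀ : IsRateBound x₀ c₀) (h₁ : IsRateBound x₁ c₁)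
    (hx₀ : 0 ≤ x₀) (hlt : x₀ < x₁) (hl : x₀ ≤ x) (hr : x ≤ x₁) :
    IsRateBound x (c₀ + (c₁ - c₀) * (x - x₀) / (x₁ - x₀)) := fun t ht => by
  have hd : 0 < x₁ - x₀ := by linarith
  have ha : 0 ≤ (x₁ - x) / (x₁ - x₀) := div_nonneg (by linarith) hd.le
  have hb : 0 ≤ (x - x₀) / (x₁ - x₀) := div_nonneg (by linarith) hd.le
  have hab : (x₁ - x) / (x₁ - x₀) + (x - x₀) / (x₁ - x₀) = 1 := by field_simp; ring
  have h1 : 1 - t ≠ 0 := by linarith [ht.2]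
  have p₀ : 0 < 1 + t * x₀ / (1 - t) := one_pos.trans_le (one_le_one_add_mul_div ht hx₀)
  have p₁ : 0 < 1 + t * x₁ / (1 - t) :=
    one_pos.trans_le (one_le_one_add_mul_div ht (by linarith))
  have key := strictConcaveOn_log_Ioi.concaveOn.2 p₀ p₁ ha hb hab
  simp only [smul_eq_mul] at key
  have e : (x₁ - x) / (x₁ - x₀) * (1 + t * x₀ / (1 - t)) +
      (x - x₀) / (x₁ - x₀) * (1 + t * x₁ / (1 - t)) = 1 + t * x / (1 - t) := by
    field_simp
    ring
  rw [e] at key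
  refine le_trans (le_of_eq ?_)
    ((add_le_add (mul_le_mul_of_nonneg_left (h₀ t ht) ha)
      (mul_le_mul_of_nonneg_left (h₁ t ht) hb)).trans key)
  field_simp
  ring

theorem one_add_mul_div_eq {t : ℝ} (ht : t < 1) (x : ℝ) :
    1 + t * x / (1 - t) = (1 + t * (x - 1)) / (1 - t) := by
  have : 1 - t ≠ 0 := by linarith
  field_simp
  ring

theorem isRateBound_one : IsRateBound 1 1 := fun t ht => by
  have h1 : 0 < 1 - t := by linarith [ht.2]
  rw [one_add_mul_div_eq ht.2, sub_self, mul_zero, add_zero, one_div, Real.log_inv]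
  linarith [Real.log_le_sub_one_of_pos h1]

/-- A critical point of `t ↦ log (1 + t x / (1 - t)) - c t` to the right of the vertex, at which
this function is nonnegative, certifies a rate bound. -/
theorem IsRateBound.of_critical {x c t₀ : ℝ} (hx : 1 ≤ x) (ht₀ : 0 ≤ t₀) (ht₁ : t₀ < 1)
    (hv : x - 2 ≤ 2 * t₀ * (x - 1)) (hc : c * ((1 + t₀ * (x - 1)) * (1 - t₀)) = x)
    (hlog : c * t₀ ≤ Real.log (1 + t₀ * x / (1 - t₀))) : IsRateBound x c := by
  set u : ℝ → ℝ := fun t => Real.log (1 + t * (x - 1)) - Real.log (1 - t) - c * t with hu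
  have hp : ∀ t : ℝ, 0 ≤ t → 0 < 1 + t * (x - 1) := fun t ht => by
    have := mul_nonneg ht (sub_nonneg.2 hx)
    linarith
  have hlogu : ∀ t : ℝ, 0 ≤ t → t < 1 → Real.log (1 + t * x / (1 - t)) - c * t = u t := by
    intro t h0 h1
    rw [one_add_mul_div_eq h1, Real.log_div (hp t h0).ne' (by linarith)]
  have hpos₀ : 0 < (1 + t₀ * (x - 1)) * (1 - t₀) := mul_pos (hp _ ht₀) (by linarith)
  have hcpos : 0 ≤ c := by
    by_contra h
    have := mul_neg_of_neg_of_pos (not_le.1 h) hpos₀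
    linarith
  -- By `hc` the quadratic numerator of u' vanishes at t₀, hence it factors; the other root is (x -
  -- 2) / (x - 1) - t₀ when x > 1, and `hv` places it at or to the left of t₀.
  have hder : ∀ t : ℝ, 0 ≤ t → t < 1 →
      HasDerivAt u (c * ((t - t₀) * ((x - 1) * (t₀ + t) - (x - 2))) /
        ((1 + t * (x - 1)) * (1 - t))) t := by
    intro t h0 h1
    have hq : 1 - t ≠ 0 := by linarith
    have hp' := (hp t h0).ne'
    have d1 : HasDerivAt (fun t : ℝ => Real.log (1 + t * (x - 1))) ((1 * (x - 1)) /
        (1 + t * (x - 1))) t :=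
      (((hasDerivAt_id t).mul_const (x - 1)).const_add 1).log hp'
    have d2 : HasDerivAt (fun t : ℝ => Real.log (1 - t)) (-1 / (1 - t)) t :=
      ((hasDerivAt_id t).const_sub 1).log hq
    have d3 : HasDerivAt (fun t : ℝ => c * t) (c * 1) t := (hasDerivAt_id t).const_mul c
    refine ((d1.sub d2).sub d3).congr_deriv ?_
    generalize hpt : 1 + t * (x - 1) = p at hp' ⊢
    rw [eq_div_iff (mul_ne_zero hp' hq)]
    have e : (1 * (x - 1) / p - -1 / (1 - t) - c * 1) * (p * (1 - t)) =
        (x - 1) * (1 - t) + p - c * (p * (1 - t)) := by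
      field_simp
      ring
    rw [e, ← hpt]
    linear_combination -hc
  have hcont : ∀ a b : ℝ, 0 ≤ a → b < 1 → ContinuousOn u (Set.Icc a b) := fun a b ha hb t ht =>
    (hder t (ha.trans ht.1) (ht.2.trans_lt hb)).continuousAt.continuousWithinAt
  have hup : ∀ a b : ℝ, 0 ≤ a → b < 1 → a ≤ b →
      (∀ t ∈ Set.Ioo a b, 0 ≤ (t - t₀) * ((x - 1) * (t₀ + t) - (x - 2))) → u a ≤ u b := by
    intro a b ha hb hab h
    refine monotoneOn_of_deriv_nonneg (convex_Icc a b) (hcont a b ha hb) ?_ ?_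
      (Set.left_mem_Icc.2 hab) (Set.right_mem_Icc.2 hab) hab
    · rw [interior_Icc]
      exact fun t ht => (hder t (ha.trans ht.1.le)
        (ht.2.trans hb)).differentiableAt.differentiableWithinAt
    · rw [interior_Icc]
      intro t ht
      rw [(hder t (ha.trans ht.1.le) (ht.2.trans hb)).deriv]
      exact div_nonneg (mul_nonneg hcpos (h t ht))
        (mul_pos (hp t (ha.trans ht.1.le)) (by linarith [ht.2])).le
  have hdown : ∀ a b : ℝ, 0 ≤ a → b < 1 → a ≤ b →
      (∀ t ∈ Set.Ioo a b, (t - t₀) * ((x - 1) * (t₀ + t) - (x - 2)) ≤ 0) → u b ≤ u a := by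
    intro a b ha hb hab h
    refine antitoneOn_of_deriv_nonpos (convex_Icc a b) (hcont a b ha hb) ?_ ?_
      (Set.left_mem_Icc.2 hab) (Set.right_mem_Icc.2 hab) hab
    · rw [interior_Icc]
      exact fun t ht => (hder t (ha.trans ht.1.le)
        (ht.2.trans hb)).differentiableAt.differentiableWithinAt
    · rw [interior_Icc]
      intro t ht
      rw [(hder t (ha.trans ht.1.le) (ht.2.trans hb)).deriv]
      exact div_nonpos_of_nonpos_of_nonneg (mul_nonpos_of_nonneg_of_nonpos hcpos (h t ht))
        (mul_pos (hp t (ha.trans ht.1.le)) (by linarith [ht.2])).le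
  have hu₀ : 0 ≤ u t₀ := by
    rw [← hlogu t₀ ht₀ ht₁]
    linarith
  have hu0 : u 0 = 0 := by simp [hu]
  intro t ht
  -- u rises from u 0 = 0 up to the smaller root (if that is positive), falls until t₀ and rises
  -- again, so its minimum is u 0 or u t₀.
  have goal : 0 ≤ u t := by
    rcases le_total t₀ t with h | h
    · refine hu₀.trans (hup t₀ t ht₀ ht.2 h fun s hs => ?_)
      have : (x - 1) * t₀ ≤ (x - 1) * s := mul_le_mul_of_nonneg_left hs.1.le (by linarith)
      exact mul_nonneg (by linarith [hs.1]) (by linarith)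
    · rcases le_total (x - 2) ((x - 1) * (t₀ + t)) with h' | h'
      · refine hu₀.trans (hdown t t₀ ht.1.le ht₁ h fun s hs => ?_)
        have : (x - 1) * t ≤ (x - 1) * s := mul_le_mul_of_nonneg_left hs.1.le (by linarith)
        exact mul_nonpos_of_nonpos_of_nonneg (by linarith [hs.2]) (by linarith)
      · rw [← hu0]
        refine hup 0 t le_rfl ht.2 ht.1.le fun s hs => ?_
        have : (x - 1) * s ≤ (x - 1) * t := mul_le_mul_of_nonneg_left hs.2.le (by linarith)
        exact mul_nonneg_of_nonpos_of_nonpos (by linarith [hs.2]) (by linarith)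
  rw [← hlogu t ht.1.le ht.2] at goal
  linarith

/-- The critical point is t = 0; the chord from (1, 1) to (2, 2) is then the limiting rate c = x. -/
theorem isRateBound_two : IsRateBound 2 2 :=
  .of_critical one_le_two le_rfl one_pos (by norm_num) (by norm_num) (by simp)

/-- The rate bounds on the curve of the tangent parameters, with `E` in the place of `exp w`. -/
theorem isRateBound_of_exp_le {w E : ℝ} (hw : 0 < w) (hE : Real.exp w ≤ E)
    (hD : 0 < E * w - E + 1) (hv : 2 * (E - 1) ≤ w * (E + 1)) :
    IsRateBound ((E - 1) ^ 2 / (E * w - E + 1)) (E * w ^ 2 / (E * w - E + 1)) := by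
  have hw1 : w + 1 ≤ E := (Real.add_one_le_exp w).trans hE
  have hE0 : 0 < E := by linarith
  have hE1 : 0 < E - 1 := by linarith
  have hEw : 0 < E * w := mul_pos hE0 hw
  set D := E * w - E + 1 with hDdef
  have ht : 1 - D / (E * w) = (E - 1) / (E * w) := by
    field_simp
    ring
  have hx : 1 ≤ (E - 1) ^ 2 / D := by
    rw [le_div_iff₀ hD]
    nlinarith
  -- This t₀ makes 1 + t₀ x / (1 - t₀) = E and c t₀ = w. With E = exp w the bound is attained at t₀;
  -- a larger E only helps the logarithm.
  refine .of_critical (t₀ := D / (E * w)) hx (by positivity) ?_ ?_ ?_ ?_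
  · rw [div_lt_one hEw]
    linarith
  · have e : 2 * (D / (E * w)) * ((E - 1) ^ 2 / D - 1) = 2 * (E - 1) / w - 2 := by
      field_simp
      rw [hDdef]
      ring
    -- Cleared of denominators, this is `hv`.
    have : (E - 1) ^ 2 / D ≤ 2 * (E - 1) / w := by
      rw [div_le_div_iff₀ hD hw]
      nlinarith
    linarith
  · rw [ht]
    have e : 1 + D / (E * w) * ((E - 1) ^ 2 / D - 1) = (E - 1) / w := by
      field_simp
      rw [hDdef]
      ring
    rw [e]
    field_simp
  · rw [ht]
    have e : 1 + D / (E * w) * ((E - 1) ^ 2 / D) / ((E - 1) / (E * w)) = E := by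
      field_simp
      ring
    have e' : E * w ^ 2 / D * (D / (E * w)) = w := by
      field_simp
    rw [e, e', Real.le_log_iff_exp_le hE0]
    exact hE

theorem IsRateBound.exp_le_growth {x c : ℝ} (h : IsRateBound x c) (hx : 0 ≤ x) (d : ℕ) :
    Real.exp (c / d) ≤ growth d x := by
  refine le_ciInf fun t => ?_
  have h1 := one_le_one_add_mul_div t.2 hx
  have h0 := t.2.1
  rw [Real.rpow_def_of_pos (by linarith)]
  refine Real.exp_le_exp.2 ?_
  calc c / d = c * t * (1 / (t * d)) := by field_simp
    _ ≤ _ := mul_le_mul_of_nonneg_right (h t t.2) (by positivity)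

/-- The rate certified at x stays valid for q steps, because `auxG` and `growth` are monotone. -/
theorem IsRateBound.mul_exp_le_auxG {x c : ℝ} (h : IsRateBound x c) (hx : 0 ≤ x)
    {d l : ℕ} (hl : x ≤ auxG d l) (q : ℕ) : x * Real.exp (q / d * c) ≤ auxG d (l + q) := by
  induction q with
  | zero => simpa using hl
  | succ q ih =>
    have hle : x ≤ auxG d (l + q) := hl.trans (auxG_monotone d (Nat.le_add_right _ _))
    have h1 := (h.exp_le_growth hx d).trans (growth_mono d hx hle)
    have e : x * Real.exp (((q + 1 : ℕ) : ℝ) / d * c) =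
        x * Real.exp (q / d * c) * Real.exp (c / d) := by
      rw [mul_assoc, ← Real.exp_add]
      congr 2
      push_cast
      ring
    have h0 := one_le_auxG d (l + q)
    rw [e, ← add_assoc, auxG_succ]
    gcongr

/-! ### Fixed-point simulation of the recursion -/

/-- Evaluates `n` before it is passed to `k`. -/
def forceNat {α : Type} (n : ℕ) (k : ℕ → α) : α :=
  match n with
  | 0 => k 0
  | m + 1 => k (m + 1)

theorem forceNat_eq {α : Type} (n : ℕ) (k : ℕ → α) : forceNat n k = k n := by
  cases n <;> rfl

/-- The state of the fixed-point simulation (in units of `SimState.scale⁻¹`): the current chord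
from `(x₀, c₀)` to `(x₁, c₁)`, the upper bound `E` for `exp (i / 128)`, and the lower bound `x`
after `n` steps. -/
structure SimState where
  x₀ : ℕ
  c₀ : ℕ
  x₁ : ℕ
  c₁ : ℕ
  i : ℕ
  E : ℕ
  x : ℕ
  n : ℕ

namespace SimState

/-- The number of fixed-point units in `1`. -/
def scale : ℕ := 1000000000000000

/-- An upper bound for `exp (1 / 128)` in fixed-point units. -/
def expInv : ℕ := 1007843097206448

/-- An Euler step of length `9999999 / 10¹¹` along the current chord. -/
def euler : SimState → SimState
  | ⟨x₀, c₀, x₁, c₁, i, E, x, n⟩ =>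
    forceNat ((c₀ + (c₁ - c₀) * (x - x₀) / (x₁ - x₀)) * 9999999 / 100000000000) fun y =>
    -- The factor is 1 + y + y² / 2 ≤ exp y; the floors only lower the result.
    forceNat (x + x * (2 * scale * y + y * y) / (2 * scale * scale)) fun x' =>
    forceNat (n + 1) fun n' => ⟨x₀, c₀, x₁, c₁, i, E, x', n'⟩

/-- Proceeds to the next chord, whose right end has the tangent parameter `(i + 1) / 128`. -/
def advance : SimState → SimState
  | ⟨x₀, c₀, x₁, c₁, i, E, x, n⟩ =>
    forceNat (i + 1) fun i' =>
    forceNat (E * expInv / scale + 1) fun E' =>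
    -- In real terms D = 128 · scale · (E w - E + 1) with w = i' / 128. Below, x₂ is rounded up and
    -- c₂ down.
    forceNat (E' * i' + 128 * scale - 128 * E') fun D =>
    forceNat ((E' - scale) * (E' - scale) * 128 / D + 1) fun x₂ =>
    forceNat (E' * (i' * i') * scale / (128 * D)) fun c₂ =>
    -- The side conditions of `isRateBound_of_exp_le` and the ordering of the chord are tested here.
    -- A failed test leaves the state unchanged, so soundness never depends on success.
    cond (Nat.ble 1 D && (Nat.ble (2 * (E' - scale) * 128) (i' * (E' + scale)) &&
        (Nat.ble (x₁ + 1) x₂ && Nat.ble c₁ c₂)))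
      ⟨x₁, c₁, x₂, c₂, i', E', x, n⟩ ⟨x₀, c₀, x₁, c₁, i, E, x, n⟩

/-- A step of the simulation. -/
def step (s : SimState) : SimState :=
  cond (Nat.ble 10000 s.n) s (cond (Nat.ble s.x s.x₁) s.euler s.advance)

/-- `2 ^ k` steps of the simulation. -/
def run : ℕ → SimState → SimState
  | 0, s => s.step
  | k + 1, s => match run k s with
    | ⟨x₀, c₀, x₁, c₁, i, E, x, n⟩ => run k ⟨x₀, c₀, x₁, c₁, i, E, x, n⟩

/-- The initial state, with the chord from `(1, 1)` to `(2, 2)`. -/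
def init : SimState := ⟨scale, scale, 2 * scale, 2 * scale, 0, scale, scale, 0⟩

/-- A lower bound for the final value in fixed-point units. -/
def target : ℕ := 9765700000000000

/-- The 2¹⁴ = 16384 iterations comprise at most 10000 Euler steps; the others change the chord or,
once n = 10000, do nothing. -/
theorem target_le_run_init : Nat.ble target (run 14 init).x = true := by
  decide +kernel

attribute [irreducible] scale expInv target

/-! ### Soundness of the simulation. -/

theorem scale_pos : (0 : ℝ) < scale := by norm_num [scale]

/-- Each term of `a` dominates an Euler step of length `9999999 / 10¹¹` from the previous one. -/
def Dominates (a : ℕ → ℝ) : Prop :=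
  ∀ k x c, 0 ≤ x → 0 ≤ c → x ≤ a k → IsRateBound x c →
    x * Real.exp (9999999 / 100000000000 * c) ≤ a (k + 1)

/-- The invariant of the simulation. -/
structure Valid (a : ℕ → ℝ) (s : SimState) : Prop where
  left : IsRateBound (s.x₀ / scale) (s.c₀ / scale)
  right : IsRateBound (s.x₁ / scale) (s.c₁ / scale)
  lt : s.x₀ < s.x₁
  le : s.c₀ ≤ s.c₁
  exp_le : Real.exp (s.i / 128) ≤ s.E / scale
  left_le : s.x₀ ≤ s.x
  bound : (s.x : ℝ) / scale ≤ a s.n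
  count : s.n ≤ 10000

theorem valid_init {a : ℕ → ℝ} (ha : 1 ≤ a 0) : Valid a init := by
  have h := scale_pos.ne'
  constructor <;> simp only [init]
  · rw [div_self h]
    exact isRateBound_one
  · push_cast
    rw [mul_div_cancel_right₀ _ h]
    exact isRateBound_two
  · norm_num [scale]
  · norm_num [scale]
  · simp [div_self h]
  · exact le_rfl
  · rwa [div_self h]
  · norm_num

theorem Valid.euler {a : ℕ → ℝ} (ha : Dominates a) {s : SimState} (hs : s.Valid a)
    (hx : s.x ≤ s.x₁) (hn : s.n < 10000) : s.euler.Valid a := by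
  obtain ⟨x₀, c₀, x₁, c₁, i, E, x, n⟩ := s
  obtain ⟨hl, hr, hlt, hle, hE, hxl, hb, -⟩ := hs
  simp only at hl hr hlt hle hE hxl hb hx hn
  simp only [SimState.euler, forceNat_eq]
  set F := c₀ + (c₁ - c₀) * (x - x₀) / (x₁ - x₀) with hF
  set y := F * 9999999 / 100000000000 with hy
  have hS := scale_pos
  have hlt' : (x₀ : ℝ) < x₁ := by exact_mod_cast hlt
  have hd : (x₁ : ℝ) - x₀ ≠ 0 := by linarith
  have hF' : (F : ℝ) ≤ c₀ + (c₁ - c₀) * (x - x₀) / (x₁ - x₀) := by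
    have := Nat.cast_div_le (α := ℝ) (m := (c₁ - c₀) * (x - x₀)) (n := x₁ - x₀)
    rw [Nat.cast_mul, Nat.cast_sub hle, Nat.cast_sub hxl, Nat.cast_sub hlt.le] at this
    rw [hF, Nat.cast_add]
    linarith
  have hy' : (y : ℝ) ≤ 9999999 / 100000000000 * F := by
    have := Nat.cast_div_le (α := ℝ) (m := F * 9999999) (n := 100000000000)
    push_cast at this
    rw [hy]
    linarith
  have hrate : IsRateBound (x / scale) (F / scale) := by
    refine (hl.chord hr (by positivity) (by gcongr) (x := x / scale) (by gcongr)
      (by gcongr)).mono (by positivity) le_rfl ?_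
    refine (div_le_div_of_nonneg_right hF' hS.le).trans (le_of_eq ?_)
    rw [← sub_div, ← sub_div, ← sub_div]
    field_simp
  have hx' : ((x + x * (2 * scale * y + y * y) / (2 * scale * scale) : ℕ) : ℝ) / scale ≤
      x / scale * Real.exp (9999999 / 100000000000 * (F / scale)) := by
    have h1 := Nat.cast_div_le (α := ℝ) (m := x * (2 * scale * y + y * y))
      (n := 2 * scale * scale)
    have h2 : 1 + (y / scale : ℝ) + (y / scale : ℝ) ^ 2 / 2 ≤
        Real.exp (9999999 / 100000000000 * (F / scale)) :=
      (Real.quadratic_le_exp_of_nonneg (by positivity)).trans (Real.exp_le_exp.2 (by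
        rw [← mul_div_assoc]
        gcongr))
    refine le_trans ?_ (mul_le_mul_of_nonneg_left h2 (by positivity))
    push_cast at h1 ⊢
    rw [div_le_iff₀ hS]
    refine (add_le_add_right h1 (x : ℝ)).trans (le_of_eq ?_)
    field_simp
    ring
  refine ⟨hl, hr, hlt, hle, hE, hxl.trans (Nat.le_add_right _ _), hx'.trans ?_, hn⟩
  exact ha n _ _ (by positivity) (by positivity) hb hrate

theorem exp_inv_le : Real.exp (1 / 128) ≤ expInv / scale := by
  refine (Real.exp_bound' (n := 8) (by norm_num) (by norm_num) (by norm_num)).trans ?_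
  norm_num [Finset.sum_range_succ, Nat.factorial, scale, expInv]

theorem Valid.advance {a : ℕ → ℝ} {s : SimState} (hs : s.Valid a)
    (hx : s.x₁ < s.x) : s.advance.Valid a := by
  obtain ⟨x₀, c₀, x₁, c₁, i, E, x, n⟩ := s
  simp only [SimState.advance, forceNat_eq]
  generalize hE' : E * expInv / scale + 1 = E'
  generalize hD : E' * (i + 1) + 128 * scale - 128 * E' = D
  cases hc : (Nat.ble 1 _ && _) with
  | false => exact hs
  | true =>
    simp only [Bool.and_eq_true, Nat.ble_eq] at hc
    obtain ⟨-, hr, hlt, -, hE, -, hb, hn⟩ := hs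
    simp only at hr hlt hE hb hx hn
    obtain ⟨hD1, hv, hx₂, hc₂⟩ := hc
    have hS := scale_pos
    have hexp : Real.exp (((i + 1 : ℕ) : ℝ) / 128) ≤ E' / scale := by
      have h1 : (E * expInv : ℝ) / scale ≤ E' := by
        have := Nat.lt_div_mul_add (a := E * expInv) (b := scale)
          (by norm_num [scale])
        rw [div_le_iff₀ hS, ← hE']
        have h2 : E * expInv ≤ (E * expInv / scale + 1) * scale := by
          rw [add_mul, one_mul]
          exact this.le
        exact_mod_cast h2
      push_cast
      rw [add_div, Real.exp_add]
      calc Real.exp (i / 128) * Real.exp (1 / 128)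
          ≤ E / scale * (expInv / scale) := by
            gcongr
            exact exp_inv_le
        _ = E * expInv / scale / scale := by ring
        _ ≤ E' / scale := by gcongr
    have hw : (0 : ℝ) < ((i + 1 : ℕ) : ℝ) / 128 := by positivity
    have hE1 : scale ≤ E' := by
      have h := (Real.one_le_exp hw.le).trans hexp
      rw [le_div_iff₀ hS, one_mul] at h
      exact_mod_cast h
    have hDr : (D : ℝ) = E' * (i + 1) + 128 * scale - 128 * E' := by
      rw [← hD, Nat.cast_sub (by omega)]
      push_cast
      ring
    have hD0 : (0 : ℝ) < D := by exact_mod_cast hD1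
    have hDw : (E' / scale : ℝ) * (((i + 1 : ℕ) : ℝ) / 128) - E' / scale + 1 =
        D / (128 * scale) := by
      rw [hDr]
      push_cast
      field_simp
      ring
    have hvr : 2 * ((E' - scale : ℝ)) * 128 ≤ (i + 1) * (E' + scale) := by
      have : ((2 * (E' - scale) * 128 : ℕ) : ℝ) ≤ ((i + 1) * (E' + scale) : ℕ) := by
        exact_mod_cast hv
      rw [Nat.cast_mul, Nat.cast_mul, Nat.cast_sub hE1] at this
      exact_mod_cast this
    have key := isRateBound_of_exp_le hw hexp (by rw [hDw]; positivity) (by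
      push_cast
      rw [div_add_one hS.ne', div_sub_one hS.ne', ← mul_div_assoc, div_mul_div_comm,
        div_le_div_iff₀ hS (by positivity)]
      nlinarith [mul_le_mul_of_nonneg_right hvr hS.le])
    rw [hDw] at key
    refine ⟨hr, key.mono (by positivity) ?_ ?_, hx₂, hc₂, hexp, hx.le, hb, hn⟩
    · have h1 := Nat.lt_div_mul_add (a := (E' - scale) * (E' - scale) * 128) (b := D) hD1
      have h2 : (((E' - scale) * (E' - scale) * 128 : ℕ) : ℝ) ≤
          (((E' - scale) * (E' - scale) * 128 / D + 1 : ℕ) : ℝ) * D := by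
        rw [← Nat.cast_mul, add_mul, one_mul]
        exact_mod_cast h1.le
      rw [← div_le_iff₀ hD0, Nat.cast_mul, Nat.cast_mul, Nat.cast_sub hE1] at h2
      rw [le_div_iff₀ hS]
      refine le_trans (le_of_eq ?_) h2
      push_cast
      field_simp
    · have h1 := Nat.cast_div_le (α := ℝ) (m := E' * ((i + 1) * (i + 1)) * scale)
        (n := 128 * D)
      rw [div_le_iff₀ hS]
      refine h1.trans (le_of_eq ?_)
      push_cast
      field_simp

theorem Valid.step {a : ℕ → ℝ} (ha : Dominates a) {s : SimState} (hs : s.Valid a) :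
    s.step.Valid a := by
  unfold SimState.step
  simp only [Bool.cond_eq_ite, Nat.ble_eq]
  split_ifs with h1 h2
  · exact hs
  · exact hs.euler ha h2 (not_le.1 h1)
  · exact hs.advance (not_le.1 h2)

theorem Valid.run {a : ℕ → ℝ} (ha : Dominates a) (k : ℕ) {s : SimState} (hs : s.Valid a) :
    (SimState.run k s).Valid a := by
  induction k generalizing s with
  | zero => exact hs.step ha
  | succ k ih => exact ih (ih hs)

theorem Dominates.le_of_monotone {a : ℕ → ℝ} (ha : Dominates a) (h0 : 1 ≤ a 0)
    (hmono : Monotone a) : 9.7657 ≤ a 10000 := by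
  have h := (valid_init h0).run ha 14
  -- Monotonicity makes n ≤ 10000 sufficient; that all 10000 Euler steps were performed is not
  -- needed.
  refine le_trans ?_ (h.bound.trans (hmono h.count))
  have := Nat.le_of_ble_eq_true target_le_run_init
  have h' : (target : ℝ) ≤ ((run 14 init).x : ℕ) := by exact_mod_cast this
  rw [le_div_iff₀ scale_pos]
  refine le_trans ?_ h'
  norm_num [scale, target]

end SimState

/-! ### Numerical bounds for `auxG`. -/

theorem dominates_auxG {d q : ℕ} (h : (9999999 / 100000000000 : ℝ) ≤ (q : ℝ) / d) :
    SimState.Dominates fun k => auxG d (q * k) := fun k x c hx hc hk hr => by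
  -- One Euler step stands for q rounds of the recursion, of total length q / d.
  refine le_trans ?_ (hr.mul_exp_le_auxG hx hk q)
  gcongr

theorem le_auxG_mul {d q : ℕ} (h : (9999999 / 100000000000 : ℝ) ≤ (q : ℝ) / d) :
    9.7657 ≤ auxG d (q * 10000) :=
  (dominates_auxG h).le_of_monotone (one_le_auxG _ _)
    ((auxG_monotone d).comp fun _ _ h => Nat.mul_le_mul_left q h)

theorem le_auxG_tenThousand : 9.7657 ≤ auxG 10000 10000 := by
  simpa using le_auxG_mul (d := 10000) (q := 1) (by norm_num)

/-- With q = ⌊d / 10000⌋, q / d ≥ 1 / 10000 - 1 / d, which is at least 9999999 / 10¹¹ once d ≥ 10¹¹.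
This is the reason for the simulated step length. -/
theorem le_auxG_self {d : ℕ} (hd : 100000000000 ≤ d) : 9.7657 ≤ auxG d d := by
  refine (le_auxG_mul (d := d) (q := d / 10000) ?_).trans
    (auxG_monotone d (Nat.div_mul_le_self d 10000))
  have hd' : (100000000000 : ℝ) ≤ d := by exact_mod_cast hd
  have h1 : (d : ℝ) ≤ ((d / 10000 : ℕ) : ℝ) * 10000 + 10000 := by
    have : d ≤ d / 10000 * 10000 + 10000 := by omega
    exact_mod_cast this
  rw [le_div_iff₀ (by linarith)]
  linarith

/-! ### Expectations over finite types -/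

namespace PMF

variable {α β : Type*} [Fintype α] [Fintype β]

/-- The expectation of a real function on a finite type. -/
noncomputable def expect (p : PMF α) (φ : α → ℝ) : ℝ := ∑ a, (p a).toReal * φ a

theorem expect_mono (p : PMF α) {φ ψ : α → ℝ} (h : ∀ a, φ a ≤ ψ a) :
    p.expect φ ≤ p.expect ψ :=
  Finset.sum_le_sum fun a _ => mul_le_mul_of_nonneg_left (h a) ENNReal.toReal_nonneg

theorem expect_add (p : PMF α) (φ ψ : α → ℝ) :
    p.expect (fun a => φ a + ψ a) = p.expect φ + p.expect ψ := by
  simp only [expect, mul_add, Finset.sum_add_distrib]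

theorem expect_const_mul (p : PMF α) (c : ℝ) (φ : α → ℝ) :
    p.expect (fun a => c * φ a) = c * p.expect φ := by
  simp only [expect, Finset.mul_sum, mul_left_comm]

theorem expect_sum {ι : Type*} (p : PMF α) (s : Finset ι) (φ : ι → α → ℝ) :
    p.expect (fun a => ∑ i ∈ s, φ i a) = ∑ i ∈ s, p.expect (φ i) := by
  simp only [expect, Finset.mul_sum]
  exact Finset.sum_comm

theorem expect_const (p : PMF α) (c : ℝ) : p.expect (fun _ => c) = c := by
  have h : ∑ a, p a = 1 := by rw [← tsum_fintype (L := .unconditional _)]; exact p.tsum_coe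
  rw [expect, ← Finset.sum_mul, ← ENNReal.toReal_sum fun a _ => p.apply_ne_top a, h,
    ENNReal.toReal_one, one_mul]

theorem expect_pure (a : α) (φ : α → ℝ) : (PMF.pure a).expect φ = φ a := by
  classical
  simp [expect, PMF.pure_apply, apply_ite]

theorem expect_bind (p : PMF α) (k : α → PMF β) (φ : β → ℝ) :
    (p.bind k).expect φ = p.expect fun a => (k a).expect φ := by
  simp only [expect, PMF.bind_apply, tsum_fintype, Finset.mul_sum]
  rw [Finset.sum_comm]
  refine Finset.sum_congr rfl fun b _ => ?_
  rw [ENNReal.toReal_sum fun a _ => ENNReal.mul_ne_top (p.apply_ne_top a) ((k a).apply_ne_top b),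
    Finset.sum_mul]
  exact Finset.sum_congr rfl fun a _ => by rw [ENNReal.toReal_mul, mul_assoc]

theorem expect_map (p : PMF α) (g : α → β) (φ : β → ℝ) :
    (p.map g).expect φ = p.expect fun a => φ (g a) := by
  rw [← PMF.bind_pure_comp, expect_bind]
  simp only [Function.comp_apply, expect_pure]

end PMF

/-! ### Candidate functions on finsets -/

theorem IsCandidate.pos {d : ℕ} {f : ℕ → ℝ} (hf : IsCandidate d f) (l : ℕ) : 0 < f l := by
  have := hf.1 (Nat.zero_le l)
  linarith [hf.2.1]

/-- Both sides are symmetric in the arguments, so the restriction to sorted tuples is harmless. -/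
theorem IsCandidate.prod_le {d : ℕ} {f : ℕ → ℝ} (hf : IsCandidate d f) {ι : Type*}
    (T : Finset ι) (hT : T.card < d) (l : ι → ℕ) :
    ∏ s ∈ T, f (l s + 1) / f (l s) ≤ 1 + (∑ s ∈ T, f (l s)) / ((d : ℝ) - (T.card : ℝ)) := by
  let l' : Fin T.card → ℕ := fun j => l (T.equivFin.symm j)
  let e : Fin T.card ≃ T := (Tuple.sort l').trans T.equivFin.symm
  have h := hf.2.2 T.card hT (l' ∘ Tuple.sort l') (Tuple.monotone_sort l')
  have h1 : ∏ j, f ((l' ∘ Tuple.sort l') j + 1) / f ((l' ∘ Tuple.sort l') j) =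
      ∏ s ∈ T, f (l s + 1) / f (l s) := by
    rw [← Finset.prod_coe_sort T]
    exact Fintype.prod_equiv e _ _ fun _ => rfl
  have h2 : ∑ j, f ((l' ∘ Tuple.sort l') j) = ∑ s ∈ T, f (l s) := by
    rw [← Finset.sum_coe_sort T]
    exact Fintype.sum_equiv e _ _ fun _ => rfl
  rwa [h1, h2] at h

/-! ### Survival probabilities -/

namespace OnlineInstance

variable (I : OnlineInstance)

/-- The number of neighbours of `s` among the first `i` requests. -/
def arrived (i : ℕ) (s : Fin I.numServers) : ℕ :=
  (Finset.univ.filter fun r : Fin I.numRequests => r.val < i ∧ s ∈ I.nbr r).card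

theorem arrived_zero (s : Fin I.numServers) : I.arrived 0 s = 0 := by simp [arrived]

theorem arrived_numRequests (s : Fin I.numServers) :
    I.arrived I.numRequests s = I.serverDegree s := by
  simp [arrived, serverDegree]

theorem arrived_succ {i : ℕ} (h : i < I.numRequests) (s : Fin I.numServers) :
    I.arrived (i + 1) s = if s ∈ I.nbr ⟨i, h⟩ then I.arrived i s + 1 else I.arrived i s := by
  unfold arrived
  split_ifs with hs
  · rw [← Finset.card_insert_of_notMem (a := (⟨i, h⟩ : Fin I.numRequests)) (by simp)]
    congr 1
    ext r
    simp only [Finset.mem_filter, Finset.mem_univ, true_and, Finset.mem_insert, Fin.ext_iff]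
    constructor
    · rintro ⟨h1, h2⟩
      rcases Nat.lt_succ_iff_lt_or_eq.1 h1 with h3 | h3
      · exact Or.inr ⟨h3, h2⟩
      · exact Or.inl h3
    · rintro (h1 | ⟨h1, h2⟩)
      · exact ⟨by omega, by rwa [show r = ⟨i, h⟩ from Fin.ext h1]⟩
      · exact ⟨by omega, h2⟩
  · congr 1
    ext r
    simp only [Finset.mem_filter, Finset.mem_univ, true_and]
    refine and_congr_left fun h2 => ⟨fun h1 => ?_, fun h1 => by omega⟩
    refine lt_of_le_of_ne (Nat.lt_succ_iff.1 h1) fun h3 => hs ?_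
    rwa [show r = ⟨i, h⟩ from Fin.ext h3] at h2

theorem arrivedBefore_eq {i : ℕ} (h : i < I.numRequests) (s : Fin I.numServers) :
    I.arrivedBefore ⟨i, h⟩ s = I.arrived i s := rfl

/-- The indicator that no server in `U` is matched by `M`. -/
def free (U : Finset (Fin I.numServers)) (M : I.EdgeSet) : ℝ :=
  if ∀ s ∈ U, ∀ e ∈ M, e.2 ≠ s then 1 else 0

theorem free_nonneg (U : Finset (Fin I.numServers)) (M : I.EdgeSet) : 0 ≤ I.free U M := by
  unfold free
  split_ifs <;> norm_num

theorem free_insert_le (U : Finset (Fin I.numServers)) (M : I.EdgeSet)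
    (e : Fin I.numRequests × Fin I.numServers) : I.free U (insert e M) ≤ I.free U M := by
  unfold free
  split_ifs with h1 h2
  · exact le_rfl
  · exact absurd (fun s hs e' he' => h1 s hs e' (Finset.mem_insert_of_mem he')) h2
  · norm_num
  · exact le_rfl

theorem expect_round_free_le (f : ℕ → ℝ) (U : Finset (Fin I.numServers))
    (r : Fin I.numRequests) (M : I.EdgeSet) :
    (I.round f r M).expect (I.free U) ≤ I.free U M := by
  unfold round
  split_ifs with h
  · rw [PMF.expect_map]
    exact (PMF.expect_mono _ fun s => I.free_insert_le U M (r, s)).trans_eq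
      (PMF.expect_const _ _)
  · rw [PMF.expect_pure]

/-- The survival probability of `U` in a round that offers `U` a positive weight. -/
theorem expect_round_free {f : ℕ → ℝ} (hf : Monotone f) (h0 : f 0 = 1)
    {U : Finset (Fin I.numServers)} {r : Fin I.numRequests} {M : I.EdgeSet}
    (hU : ∀ s ∈ U, ∀ e ∈ M, e.2 ≠ s) (hne : (I.nbr r ∩ U).Nonempty) :
    (I.round f r M).expect (I.free U) =
      (∑ s ∈ I.nbr r \ U, f (I.arrivedBefore r s) * I.free (insert s U) M) /
      (∑ s ∈ I.nbr r \ U, f (I.arrivedBefore r s) * I.free (insert s U) M +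
        ∑ s ∈ I.nbr r ∩ U, f (I.arrivedBefore r s)) := by
  have hpos : ∀ l, 0 ≤ f l := fun l => by linarith [hf (Nat.zero_le l)]
  have hA : (I.available r M).Nonempty := by
    obtain ⟨s, hs⟩ := hne
    rw [Finset.mem_inter] at hs
    exact ⟨s, Finset.mem_filter.2 ⟨hs.1, hU s hs.2⟩⟩
  have hins : ∀ s, I.free (insert s U) M = if ∀ e ∈ M, e.2 ≠ s then 1 else 0 := fun s => by
    unfold free
    refine if_congr ⟨fun h => h s (Finset.mem_insert_self s U), fun h s' hs' => ?_⟩ rfl rfl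
    rcases Finset.mem_insert.1 hs' with rfl | h'
    · exact h
    · exact hU s' h'
  have hw : ∀ s, (I.weight f r M s).toReal =
      if s ∈ I.available r M then f (I.arrivedBefore r s) else 0 := fun s => by
    unfold weight
    split_ifs
    · exact ENNReal.toReal_ofReal (hpos _)
    · rfl
  have hsum : (∑' s, I.weight f r M s).toReal = ∑ s, (I.weight f r M s).toReal := by
    rw [tsum_fintype, ENNReal.toReal_sum]
    exact fun s _ => ENNReal.ne_top_of_tsum_ne_top (I.tsum_weight_ne_top f r M) s
  have hout : ∑ s, (I.weight f r M s).toReal * I.free U (insert (r, s) M) =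
      ∑ s ∈ I.nbr r \ U, f (I.arrivedBefore r s) * I.free (insert s U) M := by
    rw [← Finset.sum_filter_add_sum_filter_not Finset.univ (fun s => s ∈ I.nbr r \ U),
      Finset.filter_univ_mem]
    rw [Finset.sum_eq_zero (s := Finset.univ.filter _), add_zero]
    · refine Finset.sum_congr rfl fun s hs => ?_
      rw [Finset.mem_sdiff] at hs
      have hfree : I.free U (insert (r, s) M) = 1 := if_pos fun s' hs' e he => by
        rcases Finset.mem_insert.1 he with rfl | h'
        · rintro rfl
          exact hs.2 hs'
        · exact hU s' hs' e h'
      rw [hw, hins, hfree, mul_one]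
      simp only [available, Finset.mem_filter, hs.1, true_and, mul_ite, mul_one, mul_zero]
    · intro s hs
      simp only [Finset.mem_filter, Finset.mem_univ, true_and, Finset.mem_sdiff, not_and,
        not_not] at hs
      by_cases hN : s ∈ I.nbr r
      · have : I.free U (insert (r, s) M) = 0 := if_neg fun h =>
          h s (hs hN) (r, s) (Finset.mem_insert_self _ _) rfl
        rw [this, mul_zero]
      · rw [hw, if_neg (show s ∉ I.available r M from fun h => hN (Finset.mem_filter.1 h).1),
          zero_mul]
  have htot : ∑ s, (I.weight f r M s).toReal =
      ∑ s ∈ I.nbr r \ U, f (I.arrivedBefore r s) * I.free (insert s U) M +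
        ∑ s ∈ I.nbr r ∩ U, f (I.arrivedBefore r s) := by
    simp only [hw]
    rw [Finset.sum_ite_mem, Finset.univ_inter, available, Finset.sum_filter,
      ← Finset.sum_sdiff (Finset.inter_subset_left (s₁ := I.nbr r) (s₂ := U)),
      Finset.sdiff_inter_self_left]
    congr 1
    · exact Finset.sum_congr rfl fun s _ => by rw [hins, mul_ite, mul_one, mul_zero]
    · exact Finset.sum_congr rfl fun s hs => if_pos (hU s (Finset.mem_inter.1 hs).2)
  have hne0 := (I.tsum_weight_ne_zero_iff f hf h0 r M).2 hA
  unfold round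
  rw [dif_pos hne0, PMF.expect_map, PMF.expect]
  simp only [PMF.normalize_apply, ENNReal.toReal_mul, ENNReal.toReal_inv]
  rw [hsum, htot, ← hout, div_eq_mul_inv, Finset.sum_mul]
  exact Finset.sum_congr rfl fun s _ => mul_right_comm _ _ _

/-- Tangent line bound for the concave function `x ↦ x / (x + c)`. -/
theorem div_add_le_tangent {x c y : ℝ} (hx : 0 ≤ x) (hc : 0 < c) (hy : 0 < y) :
    x / (x + c) ≤ y ^ 2 / (y + c) ^ 2 + c / (y + c) ^ 2 * x := by
  rw [← mul_div_right_comm, ← add_div, div_le_div_iff₀ (by positivity) (by positivity)]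
  nlinarith [mul_nonneg hc.le (sq_nonneg (x - y))]

theorem expect_round_free_le_tangent {f : ℕ → ℝ} (hf : Monotone f) (h0 : f 0 = 1)
    {U : Finset (Fin I.numServers)} {r : Fin I.numRequests} (M : I.EdgeSet)
    (hne : (I.nbr r ∩ U).Nonempty) {y c : ℝ} (hy : 0 < y)
    (hc : c = ∑ s ∈ I.nbr r ∩ U, f (I.arrivedBefore r s)) :
    (I.round f r M).expect (I.free U) ≤ y ^ 2 / (y + c) ^ 2 * I.free U M +
      c / (y + c) ^ 2 *
        ∑ s ∈ I.nbr r \ U, f (I.arrivedBefore r s) * I.free (insert s U) M := by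
  have hpos : ∀ l, 0 < f l := fun l => by linarith [hf (Nat.zero_le l)]
  have hc0 : 0 < c := hc ▸ Finset.sum_pos (fun _ _ => hpos _) hne
  have hX : 0 ≤ ∑ s ∈ I.nbr r \ U, f (I.arrivedBefore r s) * I.free (insert s U) M :=
    Finset.sum_nonneg fun s _ => mul_nonneg (hpos _).le (I.free_nonneg _ _)
  by_cases hU : ∀ s ∈ U, ∀ e ∈ M, e.2 ≠ s
  · rw [I.expect_round_free hf h0 hU hne, ← hc, show I.free U M = 1 from if_pos hU, mul_one]
    exact div_add_le_tangent hX hc0 hy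
  · refine (I.expect_round_free_le f U r M).trans ?_
    rw [show I.free U M = 0 from if_neg hU]
    positivity

/-- The probability that no server in `U` is matched after the first `i` requests. -/
noncomputable def survival (f : ℕ → ℝ) (i : ℕ) (U : Finset (Fin I.numServers)) : ℝ :=
  (I.lawAfter f i).expect (I.free U)

theorem survival_succ (f : ℕ → ℝ) {i : ℕ} (h : i < I.numRequests)
    (U : Finset (Fin I.numServers)) :
    I.survival f (i + 1) U =
      (I.lawAfter f i).expect fun M => (I.round f ⟨i, h⟩ M).expect (I.free U) := by
  rw [survival, lawAfter, PMF.expect_bind]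
  simp only [h, dif_pos]

/-- The bound must be proved for all U at once: a round for U calls on the sets `insert s U` with s
a neighbour outside U. -/
theorem survival_le {d : ℕ} {f : ℕ → ℝ} (hf : IsCandidate d f)
    (hI : ∀ r, I.requestDegree r ≤ d) {i : ℕ} (hi : i ≤ I.numRequests)
    (U : Finset (Fin I.numServers)) :
    I.survival f i U ≤ (∏ s ∈ U, f (I.arrived i s))⁻¹ := by
  induction i generalizing U with
  | zero =>
    rw [survival, lawAfter, PMF.expect_pure]
    simp [arrived_zero, hf.2.1, free]
  | succ i ih =>
    have h : i < I.numRequests := hi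
    replace ih := ih h.le
    have hprod : ∏ s ∈ U, f (I.arrived (i + 1) s) = (∏ s ∈ U, f (I.arrived i s)) *
        ∏ s ∈ I.nbr ⟨i, h⟩ ∩ U, f (I.arrived i s + 1) / f (I.arrived i s) := by
      rw [Finset.inter_comm, ← Finset.prod_ite_mem, ← Finset.prod_mul_distrib]
      refine Finset.prod_congr rfl fun s _ => ?_
      rw [I.arrived_succ h]
      split_ifs
      · rw [mul_div_cancel₀ _ (hf.pos _).ne']
      · rw [mul_one]
    set N := I.nbr ⟨i, h⟩ with hN
    have hQ : 0 < ∏ s ∈ U, f (I.arrived i s) := Finset.prod_pos fun _ _ => hf.pos _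
    have hQ' : 0 < ∏ s ∈ U, f (I.arrived (i + 1) s) := Finset.prod_pos fun _ _ => hf.pos _
    rw [I.survival_succ f h]
    rcases (N ∩ U).eq_empty_or_nonempty with hT | hT
    · rw [hT, Finset.prod_empty, mul_one] at hprod
      rw [hprod]
      exact (PMF.expect_mono _ fun M => I.expect_round_free_le f U ⟨i, h⟩ M).trans (ih U)
    have hcard : (N \ U).card + (N ∩ U).card ≤ d := by
      rw [Finset.card_sdiff_add_card_inter]
      exact hI ⟨i, h⟩
    set c := ∑ s ∈ N ∩ U, f (I.arrived i s) with hc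
    have hc0 : 0 < c := Finset.sum_pos (fun _ _ => hf.pos _) hT
    -- Jensen by linearising at y. In the expected outer weight, f(l_s) cancels against the extra
    -- factor for `insert s U`, leaving at most |N \ U| ≤ y times the bound for U; finally (y² + c
    -- y) / (y + c)² = y / (y + c).
    have hbound : ∀ y : ℝ, 0 < y → (((N \ U).card : ℕ) : ℝ) ≤ y →
        (I.lawAfter f i).expect (fun M => (I.round f ⟨i, h⟩ M).expect (I.free U)) ≤
          (∏ s ∈ U, f (I.arrived i s))⁻¹ * (y / (y + c)) := by
      intro y hy hNy
      refine (PMF.expect_mono _ fun M =>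
        I.expect_round_free_le_tangent hf.1 hf.2.1 M hT hy hc).trans ?_
      rw [PMF.expect_add, PMF.expect_const_mul, PMF.expect_const_mul, PMF.expect_sum]
      have hsum : ∑ s ∈ N \ U, (I.lawAfter f i).expect
          (fun M => f (I.arrivedBefore ⟨i, h⟩ s) * I.free (insert s U) M) ≤
          y * (∏ s ∈ U, f (I.arrived i s))⁻¹ := by
        refine (Finset.sum_le_card_nsmul _ _ (∏ s ∈ U, f (I.arrived i s))⁻¹
          fun s hs => ?_).trans ?_
        · rw [PMF.expect_const_mul, arrivedBefore_eq]
          have := ih (insert s U)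
          rw [Finset.prod_insert (Finset.mem_sdiff.1 hs).2, mul_inv] at this
          calc _ ≤ f (I.arrived i s) * ((f (I.arrived i s))⁻¹ * _) :=
                mul_le_mul_of_nonneg_left this (hf.pos _).le
            _ = _ := mul_inv_cancel_left₀ (hf.pos _).ne' _
        · rw [nsmul_eq_mul]
          gcongr
      calc _ ≤ y ^ 2 / (y + c) ^ 2 * (∏ s ∈ U, f (I.arrived i s))⁻¹ +
            c / (y + c) ^ 2 * (y * (∏ s ∈ U, f (I.arrived i s))⁻¹) := by
            gcongr
            exact ih U
        _ = _ := by
            field_simp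
    -- For m = |N ∩ U| < d take y = d - m: the candidate inequality bounds y / (y + c) by the
    -- inverse product of the ratios. Otherwise all neighbours lie in U, and U cannot survive the
    -- round.
    rcases lt_or_ge (N ∩ U).card d with hm | hm
    · have hy : (0 : ℝ) < d - (N ∩ U).card := by
        have : ((N ∩ U).card : ℝ) < d := by exact_mod_cast hm
        linarith
      refine (hbound _ hy ?_).trans ?_
      · have : (((N \ U).card : ℕ) : ℝ) + (N ∩ U).card ≤ d := by exact_mod_cast hcard
        linarith
      · have key := hf.prod_le (N ∩ U) hm (I.arrived i)
        rw [hprod, mul_inv]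
        gcongr
        rw [← hc, one_add_div hy.ne'] at key
        rw [← inv_div]
        refine inv_anti₀ (Finset.prod_pos fun _ _ => div_pos (hf.pos _) (hf.pos _)) key
    · have hN0 : N \ U = ∅ := by
        rw [← Finset.card_eq_zero]
        omega
      refine le_trans (le_of_eq ?_) (inv_pos.2 hQ').le
      have : ∀ M, (I.round f ⟨i, h⟩ M).expect (I.free U) = 0 := fun M => by
        by_cases hU : ∀ s ∈ U, ∀ e ∈ M, e.2 ≠ s
        · rw [I.expect_round_free hf.1 hf.2.1 hU hT, ← hN, hN0, Finset.sum_empty, zero_div]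
        · refine le_antisymm ((I.expect_round_free_le f U _ M).trans_eq (if_neg hU)) ?_
          exact Finset.sum_nonneg fun M _ =>
            mul_nonneg ENNReal.toReal_nonneg (I.free_nonneg _ _)
      simp only [this, PMF.expect_const]

/-! ### From survival probabilities to the competitive ratio. -/

theorem numServers_sub_le_expectedAlg (f : ℕ → ℝ) :
    (I.numServers : ℝ) - ∑ s, I.survival f I.numRequests {s} ≤ I.expectedAlg f := by
  have hcard : ∀ M : I.EdgeSet, (I.numServers : ℝ) ≤ M.card + ∑ s, I.free {s} M := by
    intro M
    have h1 : ∑ s, I.free {s} M =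
        (((Finset.univ.filter fun s => s ∉ M.image Prod.snd).card : ℕ) : ℝ) := by
      rw [Finset.natCast_card_filter]
      refine Finset.sum_congr rfl fun s _ => if_congr ?_ rfl rfl
      simp only [Finset.mem_singleton, forall_eq, Finset.mem_image, not_exists, not_and]
    have h2 := Finset.card_filter_add_card_filter_not (s := Finset.univ)
      (fun s : Fin I.numServers => s ∈ M.image Prod.snd)
    rw [Finset.filter_univ_mem, Finset.card_univ, Fintype.card_fin] at h2
    -- Counting matched servers bounds the size from below for any edge set, so M need not be known
    -- to be a matching.
    have h3 : (M.image Prod.snd).card ≤ M.card := Finset.card_image_le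
    rw [h1]
    exact_mod_cast by omega
  have := PMF.expect_mono (I.lawAfter f I.numRequests) hcard
  rw [PMF.expect_const, PMF.expect_add, PMF.expect_sum] at this
  have e : I.expectedAlg f = (I.lawAfter f I.numRequests).expect fun M => (M.card : ℝ) := rfl
  rw [e]
  unfold survival
  linarith

theorem opt_le_numServers : I.opt ≤ I.numServers := by
  classical
  refine Finset.sup_le fun M hM => ?_
  rw [Finset.mem_filter] at hM
  refine (Finset.card_le_card_of_injOn Prod.snd (t := Finset.univ)
    (fun _ _ => Finset.mem_coe.2 (Finset.mem_univ _)) fun e he e' he' h => ?_).trans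
    (Finset.card_fin _).le
  exact hM.2.2 e he e' he' (Or.inr h)

theorem le_expectedAlg {d : ℕ} {f : ℕ → ℝ} (hf : IsCandidate d f) (hI : I.IsBounded d d) :
    (1 - (f d)⁻¹) * I.numServers ≤ I.expectedAlg f := by
  refine le_trans ?_ (I.numServers_sub_le_expectedAlg f)
  have : ∑ s, I.survival f I.numRequests {s} ≤ ∑ _s : Fin I.numServers, (f d)⁻¹ := by
    refine Finset.sum_le_sum fun s _ => (I.survival_le hf hI.2 le_rfl {s}).trans ?_
    rw [Finset.prod_singleton, arrived_numRequests]
    exact inv_anti₀ (hf.pos _) (hf.1 (hI.1 s))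
  rw [Finset.sum_const, Finset.card_univ, Fintype.card_fin, nsmul_eq_mul] at this
  linarith

/-- The star with a single server and `d` requests. -/
def star (d : ℕ) : OnlineInstance := ⟨1, d, fun _ => Finset.univ⟩

theorem star_isBounded {d : ℕ} (hd : 1 ≤ d) : (star d).IsBounded d d := by
  refine ⟨fun s => ?_, fun r => ?_⟩
  · rw [serverDegree, Finset.filter_true_of_mem (p := fun r => s ∈ (star d).nbr r)
      fun _ _ => Finset.mem_univ s, Finset.card_univ]
    exact (Fintype.card_fin d).ge
  · simpa [star, requestDegree] using hd

theorem star_opt_pos {d : ℕ} (hd : 1 ≤ d) : 0 < (star d).opt := by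
  classical
  let e : Fin (star d).numRequests × Fin (star d).numServers := (⟨0, hd⟩, ⟨0, one_pos⟩)
  have hM : (star d).IsMatching {e} := by
    refine ⟨fun e _ => Finset.mem_univ _, fun e₁ h₁ e₂ h₂ _ => ?_⟩
    rw [Finset.mem_singleton.1 h₁, Finset.mem_singleton.1 h₂]
  have : ({e} : (star d).EdgeSet).card ≤ (star d).opt :=
    Finset.le_sup (f := Finset.card) (Finset.mem_filter.2 ⟨Finset.mem_univ _, hM⟩)
  rwa [Finset.card_singleton] at this

end OnlineInstance

theorem le_ocsCompetitiveRatio {d : ℕ} (hd : 1 ≤ d) {f : ℕ → ℝ} (hf : IsCandidate d f) :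
    1 - (f d)⁻¹ ≤ ocsCompetitiveRatio d d f := by
  -- The star shows that the set of ratios is nonempty; the infimum of the empty set would be 0 by
  -- convention.
  refine le_csInf ⟨_, OnlineInstance.star d, OnlineInstance.star_isBounded hd,
    OnlineInstance.star_opt_pos hd, rfl⟩ ?_
  rintro _ ⟨I, hI, hopt, rfl⟩
  have h1 : 1 ≤ f d := hf.2.1 ▸ hf.1 (Nat.zero_le d)
  have h2 : (I.opt : ℝ) ≤ I.numServers := by exact_mod_cast I.opt_le_numServers
  have h3 : 0 ≤ 1 - (f d)⁻¹ := sub_nonneg.2 (inv_le_one_of_one_le₀ h1)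
  rw [le_div_iff₀ (by exact_mod_cast hopt)]
  exact (mul_le_mul_of_nonneg_left h2 h3).trans (I.le_expectedAlg hf hI)

theorem mainTheorem5 :
    ∃ f : ℕ → ℕ → ℝ,
      (∀ d : ℕ, 2 ≤ d → IsOptimalCandidate d (f d)) ∧
      (∀ᶠ d : ℕ in Filter.atTop, (0.8976 : ℝ) ≤ ocsCompetitiveRatio d d (f d)) ∧
      (∀ d : ℕ, 2 ≤ d → ∀ l : ℕ, auxG d l ≤ f d l) ∧
      (∀ d : ℕ, 1 ≤ d → ∀ l : ℕ, auxG d l ≤ auxG (2 * d) (2 * l)) ∧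
      (9.7657 : ℝ) ≤ auxG 10000 10000 := by
  refine ⟨greedyCandidate, fun d hd => isOptimalCandidate_greedyCandidate hd, ?_,
    fun d hd l => auxG_le_greedyCandidate hd l, fun d _ l => auxG_le_auxG_two_mul d l,
    le_auxG_tenThousand⟩
  filter_upwards [Filter.eventually_ge_atTop 100000000000] with d hd
  have hd2 : 2 ≤ d := le_trans (by norm_num) hd
  have hg : 9.7657 ≤ greedyCandidate d d := (le_auxG_self hd).trans (auxG_le_greedyCandidate hd2 d)
  refine le_trans ?_ (le_ocsCompetitiveRatio (one_le_two.trans hd2)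
    (isCandidate_greedyCandidate hd2))
  -- 1 / 9.7657 < 0.1024 = 1 - 0.8976.
  have := inv_anti₀ (by norm_num) hg
  norm_num at this ⊢
  linarith
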